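/- Let $M$ be a unital $C^*$-algebra and let $\mathcal I_0\subset M$ be a two-sided ideal (a complex linear subspace with $XT,\,TX\in\mathcal I_0$ for $X\in M$, $T\in\mathcal I_0$), equipped with a norm $\|\cdot\|_{\mathcal I}$ such that $$\|XTZ\|_{\mathcal I}\le \|X\|\,\|T\|_{\mathcal I}\,\|Z\|\qquad (X,Z\in M,\ T\in\mathcal I_0).$$ Let $\mathcal I$ be the Banach space completion of $\mathcal I_0$ with respect to $\|\cdot\|_{\mathcal I}$, and for $X\in M$ let $L_X,R_X\in\mathcal B(\mathcal I)$ be the continuous extensions to $\mathcal I$ of $T\mapsto XT$ and $T\mapsto TX$. For an entire function $F$ and $B\in\mathcal B(\mathcal I)$, put $F(B)=\sum_{n\ge 0}\frac{F^{(n)}(0)}{n!}B^n\in\mathcal B(\mathcal I)$. Let $F:\mathbb C\to\mathbb C$ be an entire function with $F(0)=1$, of order of growth $$\rho=\limsup_{r\to+\infty}\frac{\ln\ln M_F(r)}{\ln r}\le 1,\qquad M_F(r)=\max_{|z|\le r}|F(z)|$$ (constant functions having order $0$), all of whose roots are purely imaginary. Let $X,Y\in M$ be self-adjoint and $A=L_X+R_Y$.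 Then $F(A)$ is invertible in $\mathcal B(\mathcal I)$ and, for every $s\in(0,1)$ and every $T\in\mathcal I$, $$\|F(sA)F(A)^{-1}T\|_{\mathcal I}\le \|e^{F'(0)(s-1)A}T\|_{\mathcal I}.$$ -/

import Mathlib

open scoped Nat

noncomputable section

/-- A complex normed ideal with a unitarily invariant norm in a unital C*-algebra `M`, before
completion: a two-sided ideal of `M` with its own norm, unrelated a priori to the norm of `M`, such
that `‖X Y Z‖_I ≤ ‖X‖ ‖Y‖_I ‖Z‖` for `X, Z` in `M` and `Y` in the ideal. -/
structure NormedIdeal (M : Type*) [CStarAlgebra M] where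
  toSubmodule : Submodule ℂ M
  mul_mem_left : ∀ (X : M) {Y : M}, Y ∈ toSubmodule → X * Y ∈ toSubmodule
  mul_mem_right : ∀ {Y : M} (Z : M), Y ∈ toSubmodule → Y * Z ∈ toSubmodule
  idealNorm : Seminorm ℂ toSubmodule
  eq_zero_of_idealNorm : ∀ Y : toSubmodule, idealNorm Y = 0 → Y = 0
  idealNorm_mul_mul_le : ∀ (X : M) (Y : toSubmodule) (Z : M),
    idealNorm ⟨X * Y * Z, mul_mem_right Z (mul_mem_left X Y.2)⟩ ≤ ‖X‖ * idealNorm Y * ‖Z‖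

namespace NormedIdeal

variable {M : Type*} [CStarAlgebra M] (I : NormedIdeal M)

/-- The ideal as a normed space under the ideal norm (a type of its own, so that it does not
inherit the norm of `M`). -/
def Pre : Type _ := I.toSubmodule

instance : AddCommGroup I.Pre := inferInstanceAs (AddCommGroup I.toSubmodule)

instance : Module ℂ I.Pre := inferInstanceAs (Module ℂ I.toSubmodule)

instance : Norm I.Pre := ⟨fun T => I.idealNorm T⟩

theorem core : NormedSpace.Core ℂ I.Pre where
  norm_nonneg T := apply_nonneg I.idealNorm T
  norm_smul c T := map_smul_eq_mul I.idealNorm c T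
  norm_triangle S T := map_add_le_add I.idealNorm S T
  norm_eq_zero_iff T := ⟨I.eq_zero_of_idealNorm T, fun h => h ▸ map_zero I.idealNorm⟩

instance : NormedAddCommGroup I.Pre := NormedAddCommGroup.ofCore I.core

instance : NormedSpace ℂ I.Pre := NormedSpace.ofCore I.core

/-- The Banach space obtained by completing the ideal with respect to the ideal norm. -/
abbrev Space : Type _ := UniformSpace.Completion I.Pre

theorem norm_one_le : ‖(1 : M)‖ ≤ 1 := by
  rcases subsingleton_or_nontrivial M with h | h
  · rw [Subsingleton.elim (1 : M) 0, norm_zero]; exact zero_le_one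
  · exact CStarRing.norm_one.le

/-- Left multiplication `T ↦ X T` on the ideal. -/
def preLeft (X : M) : I.Pre →L[ℂ] I.Pre :=
  LinearMap.mkContinuous
    ((LinearMap.mulLeft ℂ X).restrict (p := I.toSubmodule) (q := I.toSubmodule)
      fun _ h => I.mul_mem_left X h : I.toSubmodule →ₗ[ℂ] I.toSubmodule) ‖X‖ (by
    intro T
    have h := I.idealNorm_mul_mul_le X T 1
    simp only [mul_one] at h
    refine h.trans ?_
    exact mul_le_of_le_one_right (mul_nonneg (norm_nonneg X) (apply_nonneg I.idealNorm T))
      norm_one_le)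

/-- Right multiplication `T ↦ T Y` on the ideal. -/
def preRight (Y : M) : I.Pre →L[ℂ] I.Pre :=
  LinearMap.mkContinuous
    ((LinearMap.mulRight ℂ Y).restrict (p := I.toSubmodule) (q := I.toSubmodule)
      fun _ h => I.mul_mem_right Y h : I.toSubmodule →ₗ[ℂ] I.toSubmodule) ‖Y‖ (by
    intro T
    have h := I.idealNorm_mul_mul_le 1 T Y
    simp only [one_mul] at h
    refine h.trans ?_
    rw [mul_comm ‖Y‖]
    refine mul_le_mul_of_nonneg_right ?_ (norm_nonneg Y)
    exact mul_le_of_le_one_left (apply_nonneg I.idealNorm T) norm_one_le)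

/-- The unique continuous extension to the completion of a bounded operator on the ideal. -/
def extend (f : I.Pre →L[ℂ] I.Pre) : I.Space →L[ℂ] I.Space where
  toFun := UniformSpace.Completion.map f
  map_add' := (NormedAddGroupHom.completion ⟨f, map_add f, ‖f‖, f.le_opNorm⟩).map_add'
  map_smul' c x := by
    refine UniformSpace.Completion.induction_on x ?_ fun a => ?_
    · exact isClosed_eq
        (UniformSpace.Completion.continuous_map.comp (continuous_const_smul c))
        (continuous_const_smul c |>.comp UniformSpace.Completion.continuous_map)
    · rw [← UniformSpace.Completion.coe_smul,
        UniformSpace.Completion.map_coe f.uniformContinuous,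
        UniformSpace.Completion.map_coe f.uniformContinuous, map_smul,
        UniformSpace.Completion.coe_smul, RingHom.id_apply]
  cont := UniformSpace.Completion.continuous_map

/-- `L_X`, the bounded operator on the completed ideal extending `T ↦ X T`. -/
def L (X : M) : I.Space →L[ℂ] I.Space := I.extend (I.preLeft X)

/-- `R_Y`, the bounded operator on the completed ideal extending `T ↦ T Y`. -/
def R (Y : M) : I.Space →L[ℂ] I.Space := I.extend (I.preRight Y)

theorem L_coe (X : M) (T : I.Pre) : I.L X (T : I.Space) = (I.preLeft X T : I.Pre) :=
  UniformSpace.Completion.map_coe (I.preLeft X).uniformContinuous T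

theorem R_coe (Y : M) (T : I.Pre) : I.R Y (T : I.Space) = (I.preRight Y T : I.Pre) :=
  UniformSpace.Completion.map_coe (I.preRight Y).uniformContinuous T

end NormedIdeal

/-- The maximum modulus `M(r) = max_{|z| ≤ r} |F z|`. -/
def maxModulus (F : ℂ → ℂ) (r : ℝ) : ℝ :=
  sSup ((fun z => ‖F z‖) '' Metric.closedBall (0 : ℂ) r)

/-- The order of growth `limsup_{r → ∞} log log M(r) / log r` of an entire function, as an extended
real number. -/
def orderOfGrowth (F : ℂ → ℂ) : EReal :=
  Filter.limsup
    (fun r : ℝ => ((Real.log (Real.log (maxModulus F r)) / Real.log r : ℝ) : EReal)) Filter.atTop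

/-- `F(A)` for an entire function `F` and a bounded operator `A` on a Banach space (the holomorphic
functional calculus), as the Taylor series of `F` at `0` evaluated at `A`. -/
def entireCalculus {E : Type*} [NormedAddCommGroup E] [NormedSpace ℂ E]
    (F : ℂ → ℂ) (A : E →L[ℂ] E) : E →L[ℂ] E :=
  ∑' n : ℕ, ((n ! : ℂ)⁻¹ * iteratedDeriv n F 0) • A ^ n

/-- The series defining `F(A)` always converges. -/
theorem summable_entireCalculus {E : Type*} [NormedAddCommGroup E] [NormedSpace ℂ E]
    [CompleteSpace E] (F : ℂ → ℂ) (hF : Differentiable ℂ F) (A : E →L[ℂ] E) :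
    Summable fun n : ℕ => ((n ! : ℂ)⁻¹ * iteratedDeriv n F 0) • A ^ n := by
  have h := (Complex.hasSum_taylorSeries_of_entire hF 0 (‖A‖ + 1 : ℝ)).summable.norm
  rw [← summable_nat_add_iff 1] at h ⊢
  refine Summable.of_norm_bounded h fun n => ?_
  rw [norm_smul, norm_mul]
  simp only [norm_smul, sub_zero, norm_pow, norm_inv, Complex.norm_real]
  have : ‖A ^ (n + 1)‖ ≤ ‖(‖A‖ + 1 : ℝ)‖ ^ (n + 1) := by
    refine (norm_pow_le' A n.succ_pos).trans ?_
    gcongr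
    rw [Real.norm_of_nonneg (by positivity)]; linarith
  calc _ ≤ _ := mul_le_mul_of_nonneg_left this (by positivity)
    _ = _ := by ring

end

/-! The ideal enters only through one estimate: exp(itA) = L_{e^{itX}} R_{e^{itY}} with e^{itX},
e^{itY} unitary, so exp(itA) is a contraction for all real t (`norm_exp_mul_I_smul_L_add_R_le_one`).

Order at most one gives Hadamard's F(z) = e^{F'(0)z} ∏ (1 - z/ρ)e^{z/ρ}; the linear exponent is
F'(0) because each factor is 1 + O(z²). For imaginary ρ, B = ρ⁻¹A is a real multiple of iA, so the
exp(tB) are isometries. Hence 1 - B is invertible, ‖w‖ ≤ ‖w - Bw‖, and by convexity ‖w - sBw‖ ≤ ‖w -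
Bw‖. So each factor at sA is dominated by the same factor at A. The factors commute, so this passes
to products, and comparing e^{F'(0)sA} with e^{F'(0)A} leaves e^{F'(0)(s-1)A}.

Infinite products are avoided: `exists_genusOne_factorization` keeps finitely many factors and a
remainder h within ε of 1 on a ball large enough to control h(A) and h(sA). One fixed ε gives
invertibility; ε → 0 gives the inequality. -/

noncomputable section

/-! ### Finite Hadamard factorization in genus one. -/

/-- Dividing an entire function by the factor belonging to a nonzero root. -/
theorem exists_eq_one_sub_div_mul {g : ℂ → ℂ} (hg : Differentiable ℂ g) {ρ : ℂ}
    (hρ : ρ ≠ 0) (h0 : g ρ = 0) :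
    ∃ k : ℂ → ℂ, Differentiable ℂ k ∧ ∀ z, g z = (1 - z / ρ) * k z := by
  have hd : Differentiable ℂ (dslope g ρ) := by
    rw [← differentiableOn_univ] at hg ⊢
    exact (Complex.differentiableOn_dslope Filter.univ_mem).2 hg
  refine ⟨fun z => -ρ * dslope g ρ z, hd.const_mul _, fun z => ?_⟩
  have h := sub_smul_dslope g ρ z
  rw [h0, sub_zero, smul_eq_mul] at h
  rw [← h]
  field_simp
  ring

/-- On this sphere |z/ρ| ≥ 1 + c for every root. Taking c = 2 bounds the number of roots; c = 1
divides them out at no cost. -/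
theorem Multiset.le_norm_prod_one_sub_div {S : Multiset ℂ} {R c : ℝ} (hc : 0 ≤ c)
    (hS : ∀ ρ ∈ S, ρ ≠ 0 ∧ ‖ρ‖ ≤ R) {z : ℂ} (hz : ‖z‖ = (1 + c) * R) :
    c ^ S.card ≤ ‖(S.map fun ρ => 1 - z / ρ).prod‖ := by
  induction S using Multiset.induction_on with
  | empty => simp
  | cons ρ S ih =>
    have hρ := hS ρ (Multiset.mem_cons_self ρ S)
    have h1 : c ≤ ‖1 - z / ρ‖ := by
      have h2 : 1 + c ≤ ‖z / ρ‖ := by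
        rw [norm_div, le_div_iff₀ (norm_pos_iff.2 hρ.1), hz]
        exact mul_le_mul_of_nonneg_left hρ.2 (by positivity)
      have h3 := norm_sub_norm_le (z / ρ) 1
      rw [norm_one, norm_sub_rev] at h3
      linarith
    rw [Multiset.map_cons, Multiset.prod_cons, norm_mul, Multiset.card_cons, pow_succ']
    exact mul_le_mul h1 (ih fun σ hσ => hS σ (Multiset.mem_cons_of_mem hσ)) (by positivity)
      (norm_nonneg _)

/-- If `F = ∏ (1 - z / ρ) * g` with all roots `ρ` in the ball of radius `R`, then a bound on `F` on
the ball of radius `(1 + c) R` yields one on `g`. -/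
theorem norm_le_div_pow_of_eq_prod_mul {F g : ℂ → ℂ} (hg : Differentiable ℂ g) {S : Multiset ℂ}
    {R c K : ℝ} (hR : 0 < R) (hc : 0 < c) (hS : ∀ ρ ∈ S, ρ ≠ 0 ∧ ‖ρ‖ ≤ R)
    (hF : ∀ z, F z = (S.map fun ρ => 1 - z / ρ).prod * g z)
    (hK : ∀ z, ‖z‖ = (1 + c) * R → ‖F z‖ ≤ K) {z : ℂ} (hz : ‖z‖ ≤ (1 + c) * R) :
    ‖g z‖ ≤ K / c ^ S.card := by
  have hr : (1 + c) * R ≠ 0 := by positivity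
  refine Complex.norm_le_of_forall_mem_frontier_norm_le
    (U := Metric.ball (0 : ℂ) ((1 + c) * R)) Metric.isBounded_ball hg.diffContOnCl
    (fun w hw => ?_) ?_
  · rw [frontier_ball _ hr, mem_sphere_zero_iff_norm] at hw
    rw [le_div_iff₀ (by positivity), mul_comm]
    refine le_trans ?_ (hK w hw)
    rw [hF, norm_mul]
    exact mul_le_mul_of_nonneg_right (Multiset.le_norm_prod_one_sub_div hc.le hS hw)
      (norm_nonneg _)
  · rwa [closure_ball _ hr, mem_closedBall_zero_iff]

/-- The roots of an entire function in a ball, with multiplicity, can be split off. -/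
theorem exists_eq_prod_one_sub_div_mul {F : ℂ → ℂ} (hF : Differentiable ℂ F)
    (hF0 : F 0 = 1) {R : ℝ} (hR : 0 < R) :
    ∃ (S : Multiset ℂ) (g : ℂ → ℂ), Differentiable ℂ g ∧
      (∀ ρ ∈ S, (ρ ≠ 0 ∧ ‖ρ‖ ≤ R) ∧ F ρ = 0) ∧
      (∀ z, F z = (S.map fun ρ => 1 - z / ρ).prod * g z) ∧ ∀ z, ‖z‖ ≤ R → g z ≠ 0 := by
  by_contra! hcon
  have key : ∀ n : ℕ, ∃ (S : Multiset ℂ) (g : ℂ → ℂ), S.card = n ∧ Differentiable ℂ g ∧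
      (∀ ρ ∈ S, (ρ ≠ 0 ∧ ‖ρ‖ ≤ R) ∧ F ρ = 0) ∧
      (∀ z, F z = (S.map fun ρ => 1 - z / ρ).prod * g z) := by
    intro n
    induction n with
    | zero => exact ⟨0, F, rfl, hF, by simp, by simp⟩
    | succ n ih =>
      obtain ⟨S, g, hn, hg, hS, hFg⟩ := ih
      obtain ⟨ρ, hρR, hρ⟩ := hcon S g hg hS hFg
      have hρ0 : ρ ≠ 0 := by
        rintro rfl
        have := hFg 0
        simp [hF0, hρ] at this
      obtain ⟨k, hk, hgk⟩ := exists_eq_one_sub_div_mul hg hρ0 hρ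
      refine ⟨ρ ::ₘ S, k, by simp [hn], hk, fun σ hσ => ?_, fun z => ?_⟩
      · rcases Multiset.mem_cons.1 hσ with rfl | hσ
        · exact ⟨⟨hρ0, hρR⟩, by rw [hFg, hρ, mul_zero]⟩
        · exact hS σ hσ
      · rw [hFg, hgk, Multiset.map_cons, Multiset.prod_cons]
        ring
  -- With c = 2, each extracted root halves the bound on g(0) = 1, so 2^n ≤ K for every n, which is
  -- absurd.
  obtain ⟨K, hK⟩ := (isCompact_closedBall (0 : ℂ) ((1 + 2) * R)).exists_bound_of_continuousOn
    hF.continuous.continuousOn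
  obtain ⟨n, hn⟩ := pow_unbounded_of_one_lt K (one_lt_two (α := ℝ))
  obtain ⟨S, g, hSn, hg, hS, hFg⟩ := key n
  have h := norm_le_div_pow_of_eq_prod_mul hg hR two_pos (fun ρ hρ => (hS ρ hρ).1) hFg
    (fun z hz => hK z (by simp [hz])) (z := 0) (by rw [norm_zero]; positivity)
  have hg0 : g 0 = 1 := by simpa [hF0] using (hFg 0).symm
  rw [hg0, norm_one, hSn, le_div_iff₀ (by positivity)] at h
  linarith

/-- A holomorphic logarithm on a ball. -/
theorem exists_log_of_ne_zero {g : ℂ → ℂ} (hg : Differentiable ℂ g) (hg0 : g 0 = 1)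
    {R : ℝ} (hR : 0 < R) (hne : ∀ z, ‖z‖ ≤ R → g z ≠ 0) :
    ∃ u : ℂ → ℂ, DifferentiableOn ℂ u (Metric.ball 0 R) ∧ u 0 = 0 ∧ deriv u 0 = deriv g 0 ∧
      ∀ z ∈ Metric.ball (0 : ℂ) R, g z = Complex.exp (u z) := by
  have hne' : ∀ z ∈ Metric.ball (0 : ℂ) R, g z ≠ 0 := fun z hz =>
    hne z (mem_ball_zero_iff.1 hz).le
  have h0 : (0 : ℂ) ∈ Metric.ball (0 : ℂ) R := Metric.mem_ball_self hR
  have hq : DifferentiableOn ℂ (fun z => deriv g z / g z) (Metric.ball 0 R) :=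
    hg.deriv.differentiableOn.div hg.differentiableOn hne'
  -- The logarithm is a primitive of g'/g, which exists on a ball.
  obtain ⟨u, hu⟩ := hq.isExactOn_ball
  refine ⟨fun z => u z - u 0,
    fun z hz => ((hu z hz).sub_const _).differentiableAt.differentiableWithinAt,
    sub_self _, ?_, fun z hz => ?_⟩
  · simp [((hu 0 h0).sub_const _).deriv, hg0]
  · have hd : ∀ w ∈ Metric.ball (0 : ℂ) R,
        HasDerivAt (fun z => g z * Complex.exp (-(u z - u 0))) 0 w := by
      intro w hw
      refine ((hg w).hasDerivAt.mul ((hu w hw).sub_const (u 0)).neg.cexp).congr_deriv ?_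
      have := hne' w hw
      simp only [Pi.neg_apply]
      field_simp
      ring
    have hc := Metric.isOpen_ball.is_const_of_deriv_eq_zero
      (convex_ball (0 : ℂ) R).isPreconnected
      (fun w hw => (hd w hw).differentiableAt.differentiableWithinAt)
      (fun w hw => (hd w hw).deriv) hz h0
    simp only [sub_self, neg_zero, Complex.exp_zero, hg0, mul_one, Complex.exp_neg] at hc
    rwa [mul_inv_eq_one₀ (Complex.exp_ne_zero _)] at hc

/-- The nonlinear part of a holomorphic function whose real part is bounded above. -/
theorem norm_sub_deriv_mul_le_of_re_le {u : ℂ → ℂ} {R K : ℝ} (hR : 0 < R) (hK : 0 < K)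
    (hu : DifferentiableOn ℂ u (Metric.ball 0 R)) (h0 : u 0 = 0)
    (hre : ∀ z ∈ Metric.ball (0 : ℂ) R, (u z).re ≤ K) {z : ℂ} (hz : ‖z‖ < R / 2) :
    ‖u z - deriv u 0 * z‖ ≤ 4 * K * (‖z‖ / (R / 2)) ^ 2 := by
  have hsub : Metric.ball (0 : ℂ) (R / 2) ⊆ Metric.ball 0 R :=
    Metric.ball_subset_ball (by linarith)
  have hmem : (0 : ℂ) ∈ Metric.ball (0 : ℂ) R := Metric.mem_ball_self hR
  have hbd : ∀ w ∈ Metric.ball (0 : ℂ) (R / 2), ‖u w‖ ≤ 2 * K := by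
    intro w hw
    have hw' := mem_ball_zero_iff.1 hw
    -- Borel–Carathéodory gives 2K|w|/(R - |w|), at most 2K on the half ball.
    refine (Complex.borelCaratheodory_zero hK hu hre hR (hsub hw) h0).trans ?_
    rw [div_le_iff₀ (by linarith)]
    nlinarith
  have hderiv : ‖deriv u 0‖ ≤ 2 * K / (R / 2) := by
    refine Complex.norm_deriv_le_div_of_mapsTo_ball (hu.mono hsub) (fun w hw => ?_) (by positivity)
    rw [h0, mem_closedBall_zero_iff]
    exact hbd w hw
  have hd : HasDerivAt u (deriv u 0) 0 :=
    (hu.differentiableAt (Metric.isOpen_ball.mem_nhds hmem)).hasDerivAt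
  -- Schwarz lemma to second order: the function is o(w) at 0. Its bound 4K is 2K for u plus 2K for
  -- the linear part.
  have h := Complex.dist_le_mul_div_pow_of_mapsTo_ball_of_isLittleO (n := 1)
    (f := fun w => u w - deriv u 0 * w) (c := 0) (z := z) (R₁ := R / 2) (R₂ := 4 * K)
    ((hu.mono hsub).sub (differentiableOn_id.const_mul _)) ?_ ?_ (by simpa using hz)
  · simpa [h0] using h
  · intro w hw
    rw [h0, mul_zero, sub_zero, mem_closedBall_zero_iff]
    have h1 := hbd w hw
    have h2 : ‖deriv u 0 * w‖ ≤ 2 * K := by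
      rw [norm_mul]
      calc _ ≤ 2 * K / (R / 2) * (R / 2) :=
            mul_le_mul hderiv (mem_ball_zero_iff.1 hw).le (norm_nonneg _) (by positivity)
        _ = 2 * K := by field_simp
    linarith [norm_sub_le (u w) (deriv u 0 * w)]
  · have := hasDerivAt_iff_isLittleO.1 hd
    simp only [h0, sub_zero, smul_eq_mul, mul_zero] at this ⊢
    refine (this.congr_left fun w => by ring).trans_isBigO ?_
    simpa using (Asymptotics.isBigO_refl (fun w : ℂ => w) _).norm_right

/-- The elementary factor `(1 - z / ρ) exp (z / ρ)` of genus one. -/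
def genusOneFactor (ρ z : ℂ) : ℂ := (1 - ρ⁻¹ * z) * Complex.exp (ρ⁻¹ * z)

theorem differentiable_genusOneFactor (ρ : ℂ) : Differentiable ℂ (genusOneFactor ρ) := by
  unfold genusOneFactor; fun_prop

theorem hasDerivAt_prod_one_sub_div (S : Multiset ℂ) :
    HasDerivAt (fun z => (S.map fun ρ => 1 - z / ρ).prod) (-(S.map fun ρ => ρ⁻¹).sum) 0 := by
  induction S using Multiset.induction_on with
  | empty => simpa using hasDerivAt_const (0 : ℂ) (1 : ℂ)
  | cons ρ S ih =>
    simp only [Multiset.map_cons, Multiset.prod_cons, Multiset.sum_cons]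
    refine ((((hasDerivAt_id (0 : ℂ)).div_const ρ).const_sub 1).mul ih).congr_deriv ?_
    simp [add_comm]

theorem prod_genusOneFactor (S : Multiset ℂ) (z : ℂ) :
    (S.map fun ρ => genusOneFactor ρ z).prod =
      (S.map fun ρ => 1 - z / ρ).prod * Complex.exp ((S.map fun ρ => ρ⁻¹).sum * z) := by
  induction S using Multiset.induction_on with
  | empty => simp
  | cons ρ S ih =>
    rw [Multiset.map_cons, Multiset.prod_cons, ih, Multiset.map_cons, Multiset.prod_cons,
      Multiset.map_cons, Multiset.sum_cons, genusOneFactor, add_mul, Complex.exp_add,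
      div_eq_mul_inv z ρ]
    ring

/-- Hadamard factorization of an entire function of genus at most one, in a form with finitely many
factors and a remainder close to `1` on a given ball. -/
theorem exists_genusOne_factorization {F : ℂ → ℂ} (hF : Differentiable ℂ F) (hF0 : F 0 = 1)
    (hgrowth : ∀ ε > 0, ∀ᶠ R : ℝ in Filter.atTop, ∀ z : ℂ, ‖z‖ = 2 * R →
      ‖F z‖ ≤ Real.exp (ε * R ^ 2)) (r ε : ℝ) (hε : 0 < ε) :
    ∃ (S : Multiset ℂ) (h : ℂ → ℂ), Differentiable ℂ h ∧ (∀ ρ ∈ S, ρ ≠ 0 ∧ F ρ = 0) ∧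
      (∀ z, F z = Complex.exp (deriv F 0 * z) *
        ((S.map fun ρ => genusOneFactor ρ z).prod * h z)) ∧
      ∀ z, ‖z‖ ≤ r → ‖h z - 1‖ ≤ ε := by
  obtain ⟨δ, hδ, hδε⟩ : ∃ δ > 0, ∀ x : ℂ, ‖x‖ ≤ δ → ‖Complex.exp x - 1‖ ≤ ε := by
    refine ⟨min 1 (ε / 2), by positivity, fun x hx => ?_⟩
    linarith [Complex.norm_exp_sub_one_le (hx.trans (min_le_left _ _)),
      hx.trans (min_le_right _ _)]
  -- With K = ηR², the bound 4K(|z|/(R/2))² equals 16η|z|²: R cancels, and this η makes it at most δ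
  -- for |z| ≤ r.
  have hη : 0 < δ / (16 * (r ^ 2 + 1)) := by positivity
  obtain ⟨R, hR, hR0, hRr⟩ := ((hgrowth _ hη).and ((Filter.eventually_gt_atTop 0).and
    (Filter.eventually_gt_atTop (2 * r)))).exists
  obtain ⟨S, g, hg, hS, hFg, hne⟩ := exists_eq_prod_one_sub_div_mul hF hF0 hR0
  have hg0 : g 0 = 1 := by simpa [hF0] using (hFg 0).symm
  obtain ⟨u, hu, hu0, hu', hgu⟩ := exists_log_of_ne_zero hg hg0 hR0 hne
  -- This identity lets the convergence factors e^{z/ρ} and the linear part of log g combine into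
  -- e^{F'(0)z}.
  have hder : deriv F 0 = -(S.map fun ρ => ρ⁻¹).sum + deriv g 0 := by
    have := ((hasDerivAt_prod_one_sub_div S).mul (hg 0).hasDerivAt).deriv
    simp only [hg0, zero_div, sub_zero, Multiset.map_const', Multiset.prod_replicate, one_pow,
      one_mul, mul_one] at this
    rw [← this]
    congr 1
    exact funext hFg
  refine ⟨S, fun z => Complex.exp (-(deriv g 0 * z)) * g z, by fun_prop,
    fun ρ hρ => ⟨(hS ρ hρ).1.1, (hS ρ hρ).2⟩, fun z => ?_, fun z hz => ?_⟩
  · simp only [prod_genusOneFactor, hFg, hder, add_mul, Complex.exp_add, neg_mul, Complex.exp_neg]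
    field_simp [Complex.exp_ne_zero]
  · have hzR : ‖z‖ < R / 2 := by linarith
    have hzb : z ∈ Metric.ball (0 : ℂ) R := by rw [mem_ball_zero_iff]; linarith
    simp only []
    rw [hgu z hzb, ← Complex.exp_add, neg_add_eq_sub, ← hu']
    refine hδε _ ?_
    have hre : ∀ w ∈ Metric.ball (0 : ℂ) R,
        (u w).re ≤ δ / (16 * (r ^ 2 + 1)) * R ^ 2 := by
      intro w hw
      have := norm_le_div_pow_of_eq_prod_mul hg hR0 one_pos (fun ρ hρ => (hS ρ hρ).1) hFg
        (fun z hz => hR z (by rw [hz]; ring)) (z := w)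
        (by linarith [mem_ball_zero_iff.1 hw])
      rw [one_pow, div_one, hgu w hw, Complex.norm_exp] at this
      exact Real.exp_le_exp.1 this
    refine (norm_sub_deriv_mul_le_of_re_le hR0 (by positivity) hu hu0 hre hzR).trans ?_
    have h1 : ‖z‖ ^ 2 ≤ r ^ 2 + 1 := by nlinarith [norm_nonneg z]
    calc _ = δ * (‖z‖ ^ 2 / (r ^ 2 + 1)) := by field_simp; ring
      _ ≤ δ := mul_le_of_le_one_right hδ.le ((div_le_one (by positivity)).2 h1)

/-- An entire function of order at most one grows more slowly than any `exp (ε R ^ 2)`. -/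
theorem norm_le_exp_of_orderOfGrowth_le_one {F : ℂ → ℂ} (hF : Differentiable ℂ F)
    (hF0 : F 0 = 1) (hord : orderOfGrowth F ≤ 1) (ε : ℝ) (hε : 0 < ε) :
    ∀ᶠ R : ℝ in Filter.atTop, ∀ z : ℂ, ‖z‖ = 2 * R → ‖F z‖ ≤ Real.exp (ε * R ^ 2) := by
  -- Any exponent strictly between 1 and 2 would do.
  have hlt : orderOfGrowth F < ((3 / 2 : ℝ) : EReal) :=
    hord.trans_lt (by exact_mod_cast (by norm_num : (1 : ℝ) < 3 / 2))
  have h1 := Filter.eventually_lt_of_limsup_lt hlt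
  have htop : Filter.Tendsto (fun R : ℝ => 2 * R) Filter.atTop Filter.atTop :=
    Filter.tendsto_id.const_mul_atTop two_pos
  have hsmall : ∀ᶠ R : ℝ in Filter.atTop, (2 * R) ^ (3 / 2 : ℝ) ≤ ε * R ^ 2 := by
    have h := (tendsto_rpow_atTop (by norm_num : (0 : ℝ) < 1 / 2)).eventually_ge_atTop (4 / ε)
    filter_upwards [htop.eventually h, Filter.eventually_gt_atTop 0] with R hR hR0
    have hmul : (2 * R) ^ (3 / 2 : ℝ) * (2 * R) ^ (1 / 2 : ℝ) = (2 * R) ^ 2 := by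
      rw [← Real.rpow_add (by positivity), ← Real.rpow_two]
      norm_num
    rw [div_le_iff₀ hε] at hR
    have := mul_le_mul_of_nonneg_left hR (by positivity : 0 ≤ (2 * R) ^ (3 / 2 : ℝ))
    rw [← mul_assoc, hmul] at this
    linarith
  filter_upwards [htop.eventually h1, hsmall, Filter.eventually_gt_atTop 1] with R hR hs hR1 z hz
  rw [EReal.coe_lt_coe_iff] at hR
  have hbdd : BddAbove ((fun z => ‖F z‖) '' Metric.closedBall (0 : ℂ) (2 * R)) :=
    (isCompact_closedBall _ _).bddAbove_image hF.continuous.norm.continuousOn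
  have hle : ∀ w : ℂ, ‖w‖ ≤ 2 * R → ‖F w‖ ≤ maxModulus F (2 * R) := fun w hw =>
    le_csSup hbdd ⟨w, by simpa using hw, rfl⟩
  refine (hle z hz.le).trans ?_
  have hM1 : 1 ≤ maxModulus F (2 * R) := by
    simpa [hF0] using hle 0 (by rw [norm_zero]; linarith)
  rw [← Real.log_le_iff_le_exp (by linarith)]
  -- If log M = 0, the iterated logarithm is a default value and carries no information; the bound
  -- is then trivial.
  rcases (Real.log_nonneg hM1).eq_or_lt with h0 | hpos
  · rw [← h0]; positivity
  · have hlog : 0 < Real.log (2 * R) := Real.log_pos (by linarith)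
    rw [div_lt_iff₀ hlog, ← Real.log_rpow (by linarith)] at hR
    exact ((Real.log_lt_log_iff hpos (by positivity)).1 hR).le.trans hs

/-! ### Multiplicativity and norm bounds for the entire functional calculus. -/

section EntireCalculus

variable {E : Type*} [NormedAddCommGroup E] [NormedSpace ℂ E]

theorem ContinuousLinearMap.norm_pow_le_pow (A : E →L[ℂ] E) (n : ℕ) : ‖A ^ n‖ ≤ ‖A‖ ^ n := by
  rcases n.eq_zero_or_pos with rfl | hn
  · rw [pow_zero, pow_zero]
    exact ContinuousLinearMap.norm_id_le
  · exact norm_pow_le' A hn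

/-- Cauchy's estimate at radius 2(‖A‖ + 1); the 2 makes the series geometric and the 1 keeps the
radius positive when A = 0. -/
theorem norm_entireCalculus_term_le {F : ℂ → ℂ} (hF : Differentiable ℂ F) (A : E →L[ℂ] E)
    {K : ℝ} (hK : ∀ z, ‖z‖ ≤ 2 * (‖A‖ + 1) → ‖F z‖ ≤ K) (n : ℕ) :
    ‖((n ! : ℂ)⁻¹ * iteratedDeriv n F 0) • A ^ n‖ ≤ K * (1 / 2) ^ n := by
  have hr : 0 < 2 * (‖A‖ + 1) := by positivity
  have hK0 : 0 ≤ K := (norm_nonneg _).trans (hK 0 (by rw [norm_zero]; exact hr.le))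
  have h := Complex.norm_iteratedDeriv_le_of_forall_mem_sphere_norm_le (c := 0) n hr
    hF.diffContOnCl (fun z hz => hK z (mem_sphere_zero_iff_norm.1 hz).le)
  rw [norm_smul, norm_mul, norm_inv, Complex.norm_natCast]
  have hfac : (0 : ℝ) < n ! := by exact_mod_cast n.factorial_pos
  calc _ ≤ ((n ! : ℝ)⁻¹ * (n ! * K / (2 * (‖A‖ + 1)) ^ n)) * (‖A‖ + 1) ^ n := by
        gcongr
        exact (A.norm_pow_le_pow n).trans (by gcongr; linarith)
    _ = K * (1 / 2) ^ n := by
        rw [mul_pow, div_pow, one_pow]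
        field_simp

theorem summable_norm_entireCalculus [CompleteSpace E] {F : ℂ → ℂ} (hF : Differentiable ℂ F) (A : E →L[ℂ] E) :
    Summable fun n : ℕ => ‖((n ! : ℂ)⁻¹ * iteratedDeriv n F 0) • A ^ n‖ := by
  obtain ⟨K, hK⟩ := (isCompact_closedBall (0 : ℂ) (2 * (‖A‖ + 1))).exists_bound_of_continuousOn
    hF.continuous.continuousOn
  exact Summable.of_nonneg_of_le (fun _ => norm_nonneg _)
    (norm_entireCalculus_term_le hF A fun z hz => hK z (by simpa using hz))
    ((summable_geometric_of_lt_one (by norm_num) (by norm_num)).mul_left K)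

theorem norm_entireCalculus_le [CompleteSpace E] {F : ℂ → ℂ} (hF : Differentiable ℂ F) (A : E →L[ℂ] E)
    {K : ℝ} (hK : ∀ z, ‖z‖ ≤ 2 * (‖A‖ + 1) → ‖F z‖ ≤ K) : ‖entireCalculus F A‖ ≤ 2 * K := by
  have h := tsum_of_norm_bounded (hasSum_geometric_two.mul_left K)
    (norm_entireCalculus_term_le hF A hK)
  rwa [mul_comm] at h

/-- The Cauchy product of the two series matches Leibniz's rule for the Taylor coefficients. -/
theorem entireCalculus_mul [CompleteSpace E] {F G : ℂ → ℂ} (hF : Differentiable ℂ F) (hG : Differentiable ℂ G)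
    (A : E →L[ℂ] E) :
    entireCalculus (fun z => F z * G z) A = entireCalculus F A * entireCalculus G A := by
  unfold entireCalculus
  rw [tsum_mul_tsum_eq_tsum_sum_antidiagonal_of_summable_norm (summable_norm_entireCalculus hF A)
    (summable_norm_entireCalculus hG A)]
  refine tsum_congr fun n => ?_
  rw [iteratedDeriv_fun_mul hF.contDiff.contDiffAt hG.contDiff.contDiffAt,
    Finset.Nat.sum_antidiagonal_eq_sum_range_succ (fun i j =>
      (((i ! : ℂ)⁻¹ * iteratedDeriv i F 0) • A ^ i) *
        (((j ! : ℂ)⁻¹ * iteratedDeriv j G 0) • A ^ j)) n, Finset.mul_sum, Finset.sum_smul]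
  refine Finset.sum_congr rfl fun i hi => ?_
  have hin : i ≤ n := Nat.lt_succ_iff.1 (Finset.mem_range.1 hi)
  rw [smul_mul_smul_comm, ← pow_add, Nat.add_sub_cancel' hin]
  congr 1
  rw [Nat.cast_choose ℂ hin]
  have h1 : (n ! : ℂ) ≠ 0 := by exact_mod_cast n.factorial_ne_zero
  field_simp

theorem entireCalculus_sub [CompleteSpace E] {F G : ℂ → ℂ} (hF : Differentiable ℂ F) (hG : Differentiable ℂ G)
    (A : E →L[ℂ] E) :
    entireCalculus (fun z => F z - G z) A = entireCalculus F A - entireCalculus G A := by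
  unfold entireCalculus
  rw [← (summable_norm_entireCalculus hF A).of_norm.tsum_sub
    (summable_norm_entireCalculus hG A).of_norm]
  refine tsum_congr fun n => ?_
  rw [iteratedDeriv_fun_sub hF.contDiff.contDiffAt hG.contDiff.contDiffAt, mul_sub, sub_smul]

theorem entireCalculus_one (A : E →L[ℂ] E) : entireCalculus (fun _ => 1) A = 1 := by
  unfold entireCalculus
  rw [tsum_eq_single 0 fun n hn => by simp [iteratedDeriv_const, hn]]
  simp

theorem entireCalculus_const_mul_id (c : ℂ) (A : E →L[ℂ] E) :
    entireCalculus (fun z => c * z) A = c • A := by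
  unfold entireCalculus
  rw [tsum_eq_single 1 fun n hn => by
    rw [iteratedDeriv_const_mul_field, iteratedDeriv_fun_id_zero]; simp [hn]]
  rw [iteratedDeriv_const_mul_field, iteratedDeriv_fun_id_zero]
  simp

theorem entireCalculus_exp (c : ℂ) (A : E →L[ℂ] E) :
    entireCalculus (fun z => Complex.exp (c * z)) A = NormedSpace.exp (c • A) := by
  rw [NormedSpace.exp_eq_tsum ℂ]
  refine tsum_congr fun n => ?_
  have : iteratedDeriv n (fun z => Complex.exp (c * z)) 0 = c ^ n := by
    rw [iteratedDeriv_comp_const_mul Complex.contDiff_exp]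
    simp [iteratedDeriv_eq_iterate, Complex.iter_deriv_exp]
  rw [this, smul_pow, smul_smul]

theorem entireCalculus_smul {F : ℂ → ℂ} (hF : Differentiable ℂ F) (c : ℂ) (A : E →L[ℂ] E) :
    entireCalculus F (c • A) = entireCalculus (fun z => F (c * z)) A := by
  refine tsum_congr fun n => ?_
  simp only [iteratedDeriv_comp_const_mul hF.contDiff, mul_zero, smul_pow, smul_smul]
  congr 1
  ring

theorem commute_entireCalculus [CompleteSpace E] {F G : ℂ → ℂ} (hF : Differentiable ℂ F) (hG : Differentiable ℂ G)
    (A : E →L[ℂ] E) : Commute (entireCalculus F A) (entireCalculus G A) := by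
  rw [Commute, SemiconjBy, ← entireCalculus_mul hF hG, ← entireCalculus_mul hG hF]
  simp only [mul_comm]

end EntireCalculus

/-! ### Generators of contractive one-parameter groups. -/

section Contraction

variable {E : Type*} [NormedAddCommGroup E] [NormedSpace ℂ E] [CompleteSpace E]

/-- Dissipativity: (1 + t)w = e^{tB}w + t(w - Bw) + o(t), so ‖w - Bw‖ < ‖w‖ would make the right
side too short for small t > 0. -/
theorem norm_le_norm_sub_of_norm_exp_le_one {B : E →L[ℂ] E}
    (hB : ∀ t : ℝ, ‖NormedSpace.exp ((t : ℂ) • B)‖ ≤ 1) (w : E) : ‖w‖ ≤ ‖w - B w‖ := by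
  by_contra! hlt
  have hd : HasDerivAt (fun t : ℝ => NormedSpace.exp ((t : ℂ) • B) w) (B w) 0 := by
    have h := ((ContinuousLinearMap.apply ℂ E w).hasFDerivAt.comp_hasDerivAt (0 : ℂ)
      (hasDerivAt_exp_smul_const B (0 : ℂ)))
    rw [zero_smul, NormedSpace.exp_zero, one_mul] at h
    refine (HasDerivAt.scomp (0 : ℝ) (h := fun t : ℝ => (t : ℂ)) h
      (Complex.ofRealCLM.hasDerivAt (x := (0 : ℝ)))).congr_deriv ?_
    simp
  have ho := (hasDerivAt_iff_isLittleO.1 hd).bound (half_pos (sub_pos.2 hlt))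
  obtain ⟨δ, hδ, hb⟩ := Metric.eventually_nhds_iff.1 ho
  have hb' := @hb (δ / 2) (by simp [abs_of_pos hδ, hδ])
  set t := δ / 2 with ht
  have ht0 : 0 < t := by positivity
  simp only [Complex.ofReal_zero, zero_smul, NormedSpace.exp_zero, one_apply_eq_self, sub_zero,
    Real.norm_of_nonneg ht0.le] at hb'
  have hexp : ‖NormedSpace.exp ((t : ℂ) • B) w‖ ≤ ‖w‖ := by
    have h := (NormedSpace.exp ((t : ℂ) • B)).le_of_opNorm_le (hB t) w
    rwa [one_mul] at h
  have heq : (1 + t) • w = NormedSpace.exp ((t : ℂ) • B) w + t • (w - B w) -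
      (NormedSpace.exp ((t : ℂ) • B) w - w - t • B w) := by
    rw [smul_sub, add_smul, one_smul]; abel
  have hn : (1 + t) * ‖w‖ ≤ ‖w‖ + t * ‖w - B w‖ + (‖w‖ - ‖w - B w‖) / 2 * t := by
    calc (1 + t) * ‖w‖ = ‖(1 + t) • w‖ := by
          rw [norm_smul, Real.norm_of_nonneg (by positivity)]
      _ ≤ _ := by
        rw [heq]
        refine (norm_sub_le _ _).trans (add_le_add ((norm_add_le _ _).trans ?_) hb')
        rw [norm_smul, Real.norm_of_nonneg ht0.le]
        gcongr
  nlinarith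

/-- Were 1 in the spectrum of B, e > 1 would lie in that of exp B, whose elements have modulus at
most 1. -/
theorem isUnit_one_sub_of_norm_exp_le_one {B : E →L[ℂ] E} (hB : ‖NormedSpace.exp B‖ ≤ 1) :
    IsUnit (1 - B) := by
  by_contra hcon
  have h1 : (1 : ℂ) ∈ spectrum ℂ B := by
    rwa [spectrum.mem_iff, map_one]
  have h2 := spectrum.norm_le_norm_mul_of_mem (spectrum.exp_mem_exp B h1)
  have h3 : ‖(1 : E →L[ℂ] E)‖ ≤ 1 := ContinuousLinearMap.norm_id_le
  have h4 : ‖NormedSpace.exp (1 : ℂ)‖ = Real.exp 1 := by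
    rw [← Complex.exp_eq_exp_ℂ, Complex.norm_exp, Complex.one_re]
  rw [h4] at h2
  have := Real.add_one_lt_exp (one_ne_zero (α := ℝ))
  nlinarith [norm_nonneg (1 : E →L[ℂ] E), norm_nonneg (NormedSpace.exp B)]

/-- w - sBw is the convex combination (1 - s)w + s(w - Bw), and ‖w‖ ≤ ‖w - Bw‖ by dissipativity. -/
theorem norm_sub_smul_le_of_norm_exp_le_one {B : E →L[ℂ] E}
    (hB : ∀ t : ℝ, ‖NormedSpace.exp ((t : ℂ) • B)‖ ≤ 1) {s : ℝ} (hs : s ∈ Set.Ioo (0 : ℝ) 1)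
    (w : E) : ‖w - (s : ℂ) • B w‖ ≤ ‖w - B w‖ := by
  have h1 := norm_le_norm_sub_of_norm_exp_le_one hB w
  have h2 : w - (s : ℂ) • B w = ((1 - s : ℝ) : ℂ) • w + (s : ℂ) • (w - B w) := by
    push_cast
    rw [smul_sub, sub_smul, one_smul]; abel
  rw [h2]
  refine (norm_add_le _ _).trans ?_
  rw [norm_smul, norm_smul, Complex.norm_real, Complex.norm_real,
    Real.norm_of_nonneg (sub_nonneg.2 hs.2.le), Real.norm_of_nonneg hs.1.le]
  nlinarith [hs.1, hs.2]

/-- The inverse exp(-tB) is a contraction too. -/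
theorem norm_exp_smul_apply_of_norm_exp_le_one {B : E →L[ℂ] E}
    (hB : ∀ t : ℝ, ‖NormedSpace.exp ((t : ℂ) • B)‖ ≤ 1) (t : ℝ) (w : E) :
    ‖NormedSpace.exp ((t : ℂ) • B) w‖ = ‖w‖ := by
  let _ : NormedAlgebra ℚ (E →L[ℂ] E) := .restrictScalars ℚ ℂ _
  have hle : ∀ (t : ℝ) (w : E), ‖NormedSpace.exp ((t : ℂ) • B) w‖ ≤ ‖w‖ := fun t w => by
    simpa using (NormedSpace.exp ((t : ℂ) • B)).le_of_opNorm_le (hB t) w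
  refine le_antisymm (hle t w) ?_
  have h := hle (-t) (NormedSpace.exp ((t : ℂ) • B) w)
  rwa [← mul_apply_eq_comp, ← NormedSpace.exp_add_of_commute
    (((Commute.refl B).smul_left _).smul_right _), Complex.ofReal_neg, neg_smul, neg_add_cancel,
    NormedSpace.exp_zero, one_apply_eq_self] at h

end Contraction

/-! ### Invertibility and the norm inequality for purely imaginary roots. -/

section ImaginaryRoots

variable {E : Type*} [NormedAddCommGroup E] [NormedSpace ℂ E]

theorem norm_exp_smul_inv_smul_le_one {A : E →L[ℂ] E}
    (hA : ∀ t : ℝ, ‖NormedSpace.exp ((t * Complex.I) • A)‖ ≤ 1) {ρ : ℂ} (hρ : ρ.re = 0) (t : ℝ) :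
    ‖NormedSpace.exp ((t : ℂ) • ρ⁻¹ • A)‖ ≤ 1 := by
  have h : (t : ℂ) * ρ⁻¹ = ((t * ρ⁻¹.im : ℝ) : ℂ) * Complex.I := by
    apply Complex.ext <;> simp [hρ]
  rw [smul_smul, h]
  exact hA _

variable [CompleteSpace E]

theorem entireCalculus_genusOneFactor (ρ : ℂ) (A : E →L[ℂ] E) :
    entireCalculus (genusOneFactor ρ) A = (1 - ρ⁻¹ • A) * NormedSpace.exp (ρ⁻¹ • A) := by
  unfold genusOneFactor
  rw [entireCalculus_mul (by fun_prop) (by fun_prop), entireCalculus_exp,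
    entireCalculus_sub (by fun_prop) (by fun_prop), entireCalculus_one,
    entireCalculus_const_mul_id]

theorem isUnit_entireCalculus_genusOneFactor {A : E →L[ℂ] E}
    (hA : ∀ t : ℝ, ‖NormedSpace.exp ((t * Complex.I) • A)‖ ≤ 1) {ρ : ℂ} (hρ : ρ.re = 0) :
    IsUnit (entireCalculus (genusOneFactor ρ) A) := by
  let _ : NormedAlgebra ℚ (E →L[ℂ] E) := .restrictScalars ℚ ℂ _
  rw [entireCalculus_genusOneFactor]
  refine (isUnit_one_sub_of_norm_exp_le_one ?_).mul (NormedSpace.isUnit_exp _)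
  simpa using norm_exp_smul_inv_smul_le_one hA hρ 1

/-- The exponential parts are isometries, so only 1 - sB and 1 - B, with B = ρ⁻¹A, need comparing.
-/
theorem norm_entireCalculus_genusOneFactor_smul_le {A : E →L[ℂ] E}
    (hA : ∀ t : ℝ, ‖NormedSpace.exp ((t * Complex.I) • A)‖ ≤ 1) {ρ : ℂ} (hρ : ρ.re = 0)
    {s : ℝ} (hs : s ∈ Set.Ioo (0 : ℝ) 1) (w : E) :
    ‖entireCalculus (genusOneFactor ρ) ((s : ℂ) • A) w‖ ≤
      ‖entireCalculus (genusOneFactor ρ) A w‖ := by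
  have hB := norm_exp_smul_inv_smul_le_one hA hρ
  have hcomm : ∀ B : E →L[ℂ] E, (1 - B) * NormedSpace.exp B = NormedSpace.exp B * (1 - B) :=
    fun B => by
      let _ : NormedAlgebra ℚ (E →L[ℂ] E) := .restrictScalars ℚ ℂ _
      exact (((Commute.one_left B).sub_left (Commute.refl B)).exp_right).eq
  have h1 := norm_exp_smul_apply_of_norm_exp_le_one hB s ((1 - (s : ℂ) • ρ⁻¹ • A) w)
  have h2 := norm_exp_smul_apply_of_norm_exp_le_one hB 1 ((1 - ρ⁻¹ • A) w)
  rw [Complex.ofReal_one, one_smul] at h2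
  rw [entireCalculus_genusOneFactor, entireCalculus_genusOneFactor, hcomm, hcomm,
    smul_comm ρ⁻¹ (s : ℂ) A, mul_apply_eq_comp, mul_apply_eq_comp, h1, h2]
  exact norm_sub_smul_le_of_norm_exp_le_one hB hs w

theorem differentiable_prod_genusOneFactor (S : Multiset ℂ) :
    Differentiable ℂ fun z => (S.map fun ρ => genusOneFactor ρ z).prod := by
  induction S using Multiset.induction_on with
  | empty => simp
  | cons ρ S ih =>
    simp only [Multiset.map_cons, Multiset.prod_cons]
    exact (differentiable_genusOneFactor ρ).mul ih

theorem isUnit_entireCalculus_prod_genusOneFactor {A : E →L[ℂ] E}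
    (hA : ∀ t : ℝ, ‖NormedSpace.exp ((t * Complex.I) • A)‖ ≤ 1) {S : Multiset ℂ}
    (hS : ∀ ρ ∈ S, ρ.re = 0) :
    IsUnit (entireCalculus (fun z => (S.map fun ρ => genusOneFactor ρ z).prod) A) := by
  induction S using Multiset.induction_on with
  | empty => simp [entireCalculus_one]
  | cons ρ S ih =>
    simp only [Multiset.map_cons, Multiset.prod_cons]
    rw [entireCalculus_mul (differentiable_genusOneFactor ρ) (differentiable_prod_genusOneFactor S)]
    exact (isUnit_entireCalculus_genusOneFactor hA (hS ρ (Multiset.mem_cons_self ρ S))).mul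
      (ih fun σ hσ => hS σ (Multiset.mem_cons_of_mem hσ))

/-- One factor at a time: the induction hypothesis changes the tail from sA to A, and commutation
brings the remaining factor outside to be compared in turn. This is why w must vary. -/
theorem norm_entireCalculus_prod_genusOneFactor_smul_le {A : E →L[ℂ] E}
    (hA : ∀ t : ℝ, ‖NormedSpace.exp ((t * Complex.I) • A)‖ ≤ 1) {S : Multiset ℂ}
    (hS : ∀ ρ ∈ S, ρ.re = 0) {s : ℝ} (hs : s ∈ Set.Ioo (0 : ℝ) 1) (w : E) :
    ‖entireCalculus (fun z => (S.map fun ρ => genusOneFactor ρ z).prod) ((s : ℂ) • A) w‖ ≤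
      ‖entireCalculus (fun z => (S.map fun ρ => genusOneFactor ρ z).prod) A w‖ := by
  induction S using Multiset.induction_on generalizing w with
  | empty => simp [entireCalculus_one]
  | cons ρ S ih =>
    have hd := differentiable_genusOneFactor ρ
    have hP := differentiable_prod_genusOneFactor S
    have hd' : Differentiable ℂ fun z => genusOneFactor ρ (s * z) := by fun_prop
    have hcomm := (commute_entireCalculus hd' hP A).eq
    rw [← entireCalculus_smul hd] at hcomm
    simp only [Multiset.map_cons, Multiset.prod_cons]
    rw [entireCalculus_mul hd hP, entireCalculus_mul hd hP, (commute_entireCalculus hd hP _).eq,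
      mul_apply_eq_comp]
    refine (ih (fun σ hσ => hS σ (Multiset.mem_cons_of_mem hσ)) _).trans ?_
    rw [← mul_apply_eq_comp, ← hcomm, mul_apply_eq_comp, mul_apply_eq_comp]
    exact norm_entireCalculus_genusOneFactor_smul_le hA (hS ρ (Multiset.mem_cons_self ρ S)) hs _

/-- An entire function of a bounded operator is close to the identity if the function is close to
`1` on a ball that contains the spectra of all `c • A`, `‖c‖ ≤ 1`. -/
theorem norm_entireCalculus_smul_sub_one_le {h : ℂ → ℂ} (hh : Differentiable ℂ h)
    (A : E →L[ℂ] E) {ε : ℝ} (hε : ∀ z, ‖z‖ ≤ 2 * (‖A‖ + 1) → ‖h z - 1‖ ≤ ε) {c : ℂ}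
    (hc : ‖c‖ ≤ 1) : ‖entireCalculus h (c • A) - 1‖ ≤ 2 * ε := by
  rw [← entireCalculus_one (c • A), ← entireCalculus_sub hh (by fun_prop)]
  refine norm_entireCalculus_le (by fun_prop) _ fun z hz => hε z (hz.trans ?_)
  have : ‖c • A‖ ≤ ‖A‖ := by
    rw [norm_smul]; exact mul_le_of_le_one_left (norm_nonneg A) hc
  linarith

variable {F : ℂ → ℂ}

theorem isUnit_entireCalculus_of_roots_imaginary (hF : Differentiable ℂ F) (hF0 : F 0 = 1)
    (hord : orderOfGrowth F ≤ 1) (hroots : ∀ z : ℂ, z ≠ 0 → F z = 0 → z.re = 0)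
    {A : E →L[ℂ] E} (hA : ∀ t : ℝ, ‖NormedSpace.exp ((t * Complex.I) • A)‖ ≤ 1) :
    IsUnit (entireCalculus F A) := by
  let _ : NormedAlgebra ℚ (E →L[ℂ] E) := .restrictScalars ℚ ℂ _
  -- Tolerance 1/4 puts h(A) within 1/2 of the identity, so a Neumann series inverts it.
  obtain ⟨S, h, hh, hS, hFS, hε⟩ := exists_genusOne_factorization hF hF0
    (norm_le_exp_of_orderOfGrowth_le_one hF hF0 hord) (2 * (‖A‖ + 1)) (1 / 4) (by norm_num)
  have hP := differentiable_prod_genusOneFactor S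
  rw [funext hFS, entireCalculus_mul (by fun_prop) (by fun_prop), entireCalculus_mul hP hh,
    entireCalculus_exp]
  refine (NormedSpace.isUnit_exp _).mul ((isUnit_entireCalculus_prod_genusOneFactor hA
    fun ρ hρ => hroots ρ (hS ρ hρ).1 (hS ρ hρ).2).mul ?_)
  have h1 := norm_entireCalculus_smul_sub_one_le hh A hε (c := 1) (by simp)
  rw [one_smul] at h1
  rw [← sub_sub_cancel 1 (entireCalculus h A)]
  refine isUnit_one_sub_of_norm_lt_one ?_
  rw [norm_sub_rev]
  linarith

theorem norm_entireCalculus_smul_le_of_roots_imaginary (hF : Differentiable ℂ F) (hF0 : F 0 = 1)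
    (hord : orderOfGrowth F ≤ 1) (hroots : ∀ z : ℂ, z ≠ 0 → F z = 0 → z.re = 0)
    {A : E →L[ℂ] E} (hA : ∀ t : ℝ, ‖NormedSpace.exp ((t * Complex.I) • A)‖ ≤ 1)
    {s : ℝ} (hs : s ∈ Set.Ioo (0 : ℝ) 1) (y : E) :
    ‖entireCalculus F ((s : ℂ) • A) y‖ ≤
      ‖NormedSpace.exp ((deriv F 0 * ((s : ℂ) - 1)) • A) (entireCalculus F A y)‖ := by
  let _ : NormedAlgebra ℚ (E →L[ℂ] E) := .restrictScalars ℚ ℂ _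
  set a := deriv F 0
  have key : ∀ ε > 0, (1 - 2 * ε) * ‖entireCalculus F ((s : ℂ) • A) y‖ ≤
      (1 + 2 * ε) * ‖NormedSpace.exp ((a * ((s : ℂ) - 1)) • A) (entireCalculus F A y)‖ := by
    intro ε hε
    -- For ε ≥ 1/2 the left side is nonpositive.
    rcases le_or_gt (1 / 2) ε with hε2 | hε2
    · exact (mul_nonpos_of_nonpos_of_nonneg (by linarith) (norm_nonneg _)).trans (by positivity)
    obtain ⟨S, h, hh, hS, hFS, hhε⟩ := exists_genusOne_factorization hF hF0
      (norm_le_exp_of_orderOfGrowth_le_one hF hF0 hord) (2 * (‖A‖ + 1)) ε hε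
    have hP := differentiable_prod_genusOneFactor S
    set P : ℂ → ℂ := fun z => (S.map fun ρ => genusOneFactor ρ z).prod
    have hfac : ∀ B : E →L[ℂ] E, entireCalculus F B =
        entireCalculus h B * (entireCalculus P B * NormedSpace.exp (a • B)) := by
      intro B
      have hPh : Differentiable ℂ fun z => (S.map fun ρ => genusOneFactor ρ z).prod * h z :=
        hP.mul hh
      rw [funext hFS, entireCalculus_mul (by fun_prop) hPh, ← entireCalculus_exp,
        (commute_entireCalculus (by fun_prop) hPh B).eq, entireCalculus_mul hP hh,
        (commute_entireCalculus hP hh B).eq, mul_assoc]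
    -- With this vector the two sides are h(sA)P(sA)w and h(A)P(A)w, since e^{a(s-1)A}e^{aA} =
    -- e^{asA}.
    set w := NormedSpace.exp ((a * s) • A) y with hw
    have hL : entireCalculus F ((s : ℂ) • A) y =
        entireCalculus h ((s : ℂ) • A) (entireCalculus P ((s : ℂ) • A) w) := by
      rw [hfac, smul_smul]; rfl
    have hR : NormedSpace.exp ((a * ((s : ℂ) - 1)) • A) (entireCalculus F A y) =
        entireCalculus h A (entireCalculus P A w) := by
      have hexp : NormedSpace.exp ((a * s) • A) =
          NormedSpace.exp (a • A) * NormedSpace.exp ((a * ((s : ℂ) - 1)) • A) := by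
        rw [← NormedSpace.exp_add_of_commute (((Commute.refl A).smul_left _).smul_right _),
          ← add_smul]
        congr 2
        ring
      rw [hw, hexp, ← mul_apply_eq_comp, ← mul_apply_eq_comp, ← mul_apply_eq_comp,
        mul_assoc, ← mul_assoc (entireCalculus P A), ← mul_assoc (entireCalculus h A), ← hfac,
        ← entireCalculus_exp, (commute_entireCalculus (by fun_prop) hF A).eq]
    have hsn : ‖(s : ℂ)‖ ≤ 1 := by
      rw [Complex.norm_real, Real.norm_of_nonneg hs.1.le]; exact hs.2.le
    have hnear : ∀ c : ℂ, ‖c‖ ≤ 1 → ∀ x : E, ‖entireCalculus h (c • A) x - x‖ ≤ 2 * ε * ‖x‖ :=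
      fun c hc x => (entireCalculus h (c • A) - 1).le_of_opNorm_le
        (norm_entireCalculus_smul_sub_one_le hh A hhε hc) x
    have h1 := hnear s hsn (entireCalculus P ((s : ℂ) • A) w)
    have h2 := hnear 1 (by simp) (entireCalculus P A w)
    have h3 := norm_entireCalculus_prod_genusOneFactor_smul_le hA
      (fun ρ hρ => hroots ρ (hS ρ hρ).1 (hS ρ hρ).2) hs w
    rw [one_smul, norm_sub_rev] at h2
    rw [hL, hR]
    have h4 := norm_sub_norm_le (entireCalculus h ((s : ℂ) • A)
      (entireCalculus P ((s : ℂ) • A) w)) (entireCalculus P ((s : ℂ) • A) w)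
    have h5 := norm_sub_norm_le (entireCalculus P A w) (entireCalculus h A (entireCalculus P A w))
    calc _ ≤ (1 - 2 * ε) * ((1 + 2 * ε) * ‖entireCalculus P A w‖) := by
          refine mul_le_mul_of_nonneg_left ?_ (by linarith)
          exact le_trans (by linarith) (mul_le_mul_of_nonneg_left h3 (by positivity))
      _ = (1 + 2 * ε) * ((1 - 2 * ε) * ‖entireCalculus P A w‖) := by ring
      _ ≤ _ := mul_le_mul_of_nonneg_left (by linarith) (by positivity)
  have hlim : ∀ x k : ℝ, Filter.Tendsto (fun ε : ℝ => (1 + k * ε) * x) (nhdsWithin 0 (Set.Ioi 0))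
      (nhds x) := fun x k => by
    have : Continuous fun ε : ℝ => (1 + k * ε) * x := by fun_prop
    simpa using (this.tendsto 0).mono_left nhdsWithin_le_nhds
  refine le_of_tendsto_of_tendsto (hlim _ (-2)) (hlim _ 2) ?_
  filter_upwards [self_mem_nhdsWithin] with ε hε
  have := key ε hε
  rwa [sub_eq_add_neg, ← neg_mul] at this

end ImaginaryRoots

/-! ### Exponentials of the multiplication operators on the ideal. -/

/-- Only powers must be preserved, so the antihomomorphism Y ↦ R_Y is covered as well. -/
theorem map_exp_of_map_pow {A B : Type*} [NormedRing A] [NormedAlgebra ℂ A] [CompleteSpace A]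
    [NormedRing B] [NormedAlgebra ℂ B] (f : A →L[ℂ] B) (hf : ∀ (x : A) (n : ℕ), f (x ^ n) = f x ^ n)
    (x : A) : f (NormedSpace.exp x) = NormedSpace.exp (f x) := by
  rw [NormedSpace.exp_eq_tsum ℂ, NormedSpace.exp_eq_tsum ℂ]
  simp only []
  rw [f.map_tsum (NormedSpace.expSeries_summable' x)]
  simp only [map_smul, hf]

namespace NormedIdeal

variable {M : Type*} [CStarAlgebra M] (I : NormedIdeal M)

theorem ext_of_coe {f g : I.Space →L[ℂ] I.Space} (h : ∀ T : I.Pre, f (T : I.Space) = g T) :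
    f = g := by
  ext x
  induction x using UniformSpace.Completion.induction_on with
  | hp => exact isClosed_eq f.continuous g.continuous
  | ih T => exact h T

theorem norm_extend_le (f : I.Pre →L[ℂ] I.Pre) : ‖I.extend f‖ ≤ ‖f‖ := by
  refine ContinuousLinearMap.opNorm_le_bound _ (norm_nonneg f) fun x => ?_
  induction x using UniformSpace.Completion.induction_on with
  | hp => exact isClosed_le (I.extend f).continuous.norm (continuous_norm.const_mul _)
  | ih T =>
    rw [show I.extend f (T : I.Space) = (f T : I.Pre) from
      UniformSpace.Completion.map_coe f.uniformContinuous T, UniformSpace.Completion.norm_coe,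
      UniformSpace.Completion.norm_coe]
    exact f.le_opNorm T

theorem norm_L_le (X : M) : ‖I.L X‖ ≤ ‖X‖ :=
  (I.norm_extend_le _).trans (LinearMap.mkContinuous_norm_le _ (norm_nonneg X) _)

theorem norm_R_le (Y : M) : ‖I.R Y‖ ≤ ‖Y‖ :=
  (I.norm_extend_le _).trans (LinearMap.mkContinuous_norm_le _ (norm_nonneg Y) _)

/-- `X ↦ L_X` as a bounded linear map. -/
def leftCLM : M →L[ℂ] (I.Space →L[ℂ] I.Space) :=
  LinearMap.mkContinuous
    { toFun := I.L
      map_add' := fun X Y => I.ext_of_coe fun T => by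
        rw [add_apply, L_coe, L_coe, L_coe, ← UniformSpace.Completion.coe_add]
        congr 1
        exact Subtype.ext (add_mul X Y T.1)
      map_smul' := fun c X => I.ext_of_coe fun T => by
        rw [RingHom.id_apply, smul_apply, L_coe, L_coe, ← UniformSpace.Completion.coe_smul]
        congr 1
        exact Subtype.ext (smul_mul_assoc c X T.1) }
    1 fun X => by simpa using I.norm_L_le X

/-- `Y ↦ R_Y` as a bounded linear map. -/
def rightCLM : M →L[ℂ] (I.Space →L[ℂ] I.Space) :=
  LinearMap.mkContinuous
    { toFun := I.R
      map_add' := fun X Y => I.ext_of_coe fun T => by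
        rw [add_apply, R_coe, R_coe, R_coe, ← UniformSpace.Completion.coe_add]
        congr 1
        exact Subtype.ext (mul_add T.1 X Y)
      map_smul' := fun c X => I.ext_of_coe fun T => by
        rw [RingHom.id_apply, smul_apply, R_coe, R_coe, ← UniformSpace.Completion.coe_smul]
        congr 1
        exact Subtype.ext (mul_smul_comm c T.1 X) }
    1 fun X => by simpa using I.norm_R_le X

theorem L_one : I.L 1 = 1 := I.ext_of_coe fun T => by
  rw [L_coe]
  exact congrArg _ (Subtype.ext (one_mul T.1))

theorem R_one : I.R 1 = 1 := I.ext_of_coe fun T => by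
  rw [R_coe]
  exact congrArg _ (Subtype.ext (mul_one T.1))

theorem L_mul (X Y : M) : I.L (X * Y) = I.L X * I.L Y := I.ext_of_coe fun T => by
  rw [mul_apply_eq_comp, L_coe, L_coe, L_coe]
  exact congrArg _ (Subtype.ext (mul_assoc X Y T.1))

theorem R_mul (X Y : M) : I.R (X * Y) = I.R Y * I.R X := I.ext_of_coe fun T => by
  rw [mul_apply_eq_comp, R_coe, R_coe, R_coe]
  exact congrArg _ (Subtype.ext (mul_assoc T.1 X Y).symm)

theorem commute_L_R (X Y : M) : Commute (I.L X) (I.R Y) := I.ext_of_coe fun T => by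
  rw [mul_apply_eq_comp, mul_apply_eq_comp, R_coe, L_coe, L_coe, R_coe]
  exact congrArg _ (Subtype.ext (mul_assoc X T.1 Y).symm)

theorem L_exp (X : M) : I.L (NormedSpace.exp X) = NormedSpace.exp (I.L X) :=
  map_exp_of_map_pow I.leftCLM (fun X n => by
    change I.L (X ^ n) = I.L X ^ n
    induction n with
    | zero => rw [pow_zero, pow_zero, L_one]
    | succ n ih => rw [pow_succ, L_mul, ih, pow_succ]) X

theorem R_exp (Y : M) : I.R (NormedSpace.exp Y) = NormedSpace.exp (I.R Y) :=
  map_exp_of_map_pow I.rightCLM (fun Y n => by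
    change I.R (Y ^ n) = I.R Y ^ n
    induction n with
    | zero => rw [pow_zero, pow_zero, R_one]
    | succ n ih => rw [pow_succ, R_mul, ih, pow_succ']) Y

theorem _root_.IsSelfAdjoint.norm_exp_mul_I_smul_le_one {X : M} (hX : IsSelfAdjoint X) (t : ℝ) :
    ‖NormedSpace.exp ((t * Complex.I) • X)‖ ≤ 1 := by
  have h := (selfAdjoint.expUnitary (t • (⟨X, hX⟩ : selfAdjoint M))).2
  rw [selfAdjoint.expUnitary_coe] at h
  have hn : ‖NormedSpace.exp (Complex.I • ((t • (⟨X, hX⟩ : selfAdjoint M) : selfAdjoint M) : M))‖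
      ≤ 1 := by
    rcases subsingleton_or_nontrivial M with _ | _
    · rw [Subsingleton.elim (NormedSpace.exp _) (0 : M), norm_zero]; exact zero_le_one
    · exact (CStarRing.norm_of_mem_unitary h).le
  convert hn using 3
  rw [mul_comm, mul_smul]
  rfl

/-- L and R commute, so the exponential splits into left and right multiplication by elements of
norm at most one. -/
theorem norm_exp_mul_I_smul_L_add_R_le_one {X Y : M} (hX : IsSelfAdjoint X)
    (hY : IsSelfAdjoint Y) (t : ℝ) :
    ‖NormedSpace.exp ((t * Complex.I) • (I.L X + I.R Y))‖ ≤ 1 := by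
  let _ : NormedAlgebra ℚ (I.Space →L[ℂ] I.Space) := .restrictScalars ℚ ℂ _
  have hL : (t * Complex.I) • I.L X = I.L ((t * Complex.I) • X) :=
    (I.leftCLM.map_smul (t * Complex.I) X).symm
  have hR : (t * Complex.I) • I.R Y = I.R ((t * Complex.I) • Y) :=
    (I.rightCLM.map_smul (t * Complex.I) Y).symm
  rw [smul_add, hL, hR, NormedSpace.exp_add_of_commute (I.commute_L_R _ _), ← L_exp, ← R_exp]
  refine (norm_mul_le _ _).trans (mul_le_one₀ ?_ (norm_nonneg _) ?_)
  · exact (I.norm_L_le _).trans (hX.norm_exp_mul_I_smul_le_one t)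
  · exact (I.norm_R_le _).trans (hY.norm_exp_mul_I_smul_le_one t)

end NormedIdeal

end

theorem mainTheorem9 {M : Type*} [CStarAlgebra M] (I : NormedIdeal M)
    (F : ℂ → ℂ) (hF : Differentiable ℂ F) (hord : orderOfGrowth F ≤ 1)
    (hroots : ∀ z : ℂ, z ≠ 0 → F z = 0 → z.re = 0) (hF0 : F 0 = 1)
    (X Y : M) (hX : IsSelfAdjoint X) (hY : IsSelfAdjoint Y) :
    IsUnit (entireCalculus F (I.L X + I.R Y)) ∧
      ∀ s : ℝ, s ∈ Set.Ioo (0 : ℝ) 1 → ∀ T : I.Space,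
        ‖entireCalculus F ((s : ℂ) • (I.L X + I.R Y))
            (Ring.inverse (entireCalculus F (I.L X + I.R Y)) T)‖ ≤
          ‖NormedSpace.exp ((deriv F 0 * ((s : ℂ) - 1)) • (I.L X + I.R Y)) T‖ := by
  have hA := I.norm_exp_mul_I_smul_L_add_R_le_one hX hY
  have hunit := isUnit_entireCalculus_of_roots_imaginary hF hF0 hord hroots hA
  refine ⟨hunit, fun s hs T => ?_⟩
  have h := norm_entireCalculus_smul_le_of_roots_imaginary hF hF0 hord hroots hA hs
    (Ring.inverse (entireCalculus F (I.L X + I.R Y)) T)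
  rwa [← mul_apply_eq_comp (entireCalculus F (I.L X + I.R Y)), Ring.mul_inverse_cancel _ hunit,
    one_apply_eq_self] at h
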